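/- Let $n$ be a natural number and $J=\begin{bmatrix}0&I_n\\-I_n&0\end{bmatrix}$. A real $2n\times 2n$ matrix $M$ is symplectic if $M^TJM=J$, and a linear subspace $W\subseteq\mathbb{R}^{2n}$ is symplectic if for every $0\neq u\in W$ there is $v\in W$ with $u^TJv\neq 0$. For a real $2n\times 2n$ matrix $A$, the vector $d(A)=(d_1(A)\le\cdots\le d_n(A))$ of symplectic eigenvalues of $A$, when it exists and is unique, is the vector with non-negative, non-decreasing entries such that $M^TAM=\begin{bmatrix}D&0\\0&D\end{bmatrix}$ with $D=\operatorname{diag}(d_1(A),\dots,d_n(A))$ for some symplectic $M$. For $x,y\in\mathbb{R}^n$, $x$ is weakly supermajorized by $y$, written $x\prec^w y$, if $\sum_{j=1}^k x_j^\uparrow\ge\sum_{j=1}^k y_j^\uparrow$ for all $1\le k\le n$, where $x^\uparrow$ is $x$ with its entries rearranged in non-decreasing order. Theorem. Let $A$ and $B$ be real symmetric positive semidefinite $2n\times 2n$ matrices whose kernels are symplectic subspaces of $\mathbb{R}^{2n}$. Suppose that $A$ lies in the convex hull of the symplectic orbit $\{M^TBM : M \text{ symplectic}\}$ of $B$, i.e.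 $A=\sum_{i=1}^m\lambda_iM_i^TBM_i$ for some symplectic matrices $M_1,\dots,M_m$ and $\lambda_i\ge 0$ with $\sum_i\lambda_i=1$. Then $d(A)$ and $d(B)$ exist and are unique, and $d(A)\prec^w d(B)$. -/

import Mathlib

open Matrix

/-- A linear subspace `W` of `ℝ²ⁿ` is symplectic if for every nonzero `u ∈ W` there is `v ∈ W` with
`uᵀ J v ≠ 0`. (Mathlib's `J` is `[[0, -1], [1, 0]]`; the overall sign plays no role here, nor in the
defining relation `Mᵀ J M = J` of `Matrix.symplecticGroup`.) -/
def IsSymplecticSubspace {n : ℕ} (W : Submodule ℝ (Fin n ⊕ Fin n → ℝ)) : Prop :=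
  ∀ u ∈ W, u ≠ 0 → ∃ v ∈ W, u ⬝ᵥ (Matrix.J (Fin n) ℝ *ᵥ v) ≠ 0

/-- The kernel of the matrix `A` is a symplectic subspace of `ℝ²ⁿ`. -/
def HasSymplecticKernel {n : ℕ} (A : Matrix (Fin n ⊕ Fin n) (Fin n ⊕ Fin n) ℝ) : Prop :=
  IsSymplecticSubspace (LinearMap.ker A.mulVecLin)

/-- The symplectic orbit `{Mᵀ B M : M ∈ Sp(2n)}` of `B`. -/
def symplecticOrbit {n : ℕ} (B : Matrix (Fin n ⊕ Fin n) (Fin n ⊕ Fin n) ℝ) :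
    Set (Matrix (Fin n ⊕ Fin n) (Fin n ⊕ Fin n) ℝ) :=
  {X | ∃ M ∈ Matrix.symplecticGroup (Fin n) ℝ, X = Mᵀ * B * M}

/-- `d` lists, in non-decreasing order, the diagonal entries of a non-negative diagonal matrix `D`
such that `Mᵀ A M = D ⊕ D` for some symplectic matrix `M`. -/
def IsSymplecticSpectrum {n : ℕ} (A : Matrix (Fin n ⊕ Fin n) (Fin n ⊕ Fin n) ℝ)
    (d : Fin n → ℝ) : Prop :=
  Monotone d ∧ (∀ i, 0 ≤ d i) ∧
    ∃ M ∈ Matrix.symplecticGroup (Fin n) ℝ,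
      Mᵀ * A * M = Matrix.fromBlocks (Matrix.diagonal d) 0 0 (Matrix.diagonal d)

open Classical in
/-- The vector `d(A)` of symplectic eigenvalues of `A`, in non-decreasing order
(zero if `A` has no symplectic spectrum). -/
noncomputable def symplecticEigenvalues {n : ℕ}
    (A : Matrix (Fin n ⊕ Fin n) (Fin n ⊕ Fin n) ℝ) : Fin n → ℝ :=
  if h : ∃ d, IsSymplecticSpectrum A d then h.choose else 0

/-- The vector `x↑` of the entries of `x` rearranged in non-decreasing order. -/
noncomputable def sortedIncreasing {n : ℕ} (x : Fin n → ℝ) : Fin n → ℝ := x ∘ Tuple.sort x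

/-- `x ≺ʷ y`: for each `k`, the sum of the `k` smallest entries of `x` is at least the sum of the
`k` smallest entries of `y`. -/
def WeaklySupermajorizedBy {n : ℕ} (x y : Fin n → ℝ) : Prop :=
  ∀ k : Fin n, ∑ j ∈ Finset.Iic k, sortedIncreasing y j ≤ ∑ j ∈ Finset.Iic k, sortedIncreasing x j

/-! The core is a variational bound: if `d` is a symplectic spectrum of `X`, then for every
symplectic `M` the trace of `Mᵀ X M` over the first `k` index pairs is at least twice the sum of the
`k` smallest `d i`, with equality when `M` diagonalizes `X`. For fixed `M` the trace is linear in
`X`, so a bound valid on the orbit of `B` holds on its convex hull; choosing `M` to diagonalize `A`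
gives the supermajorization. Uniqueness of the spectrum is the case `A = B`. For diagonal `X` the
trace is a combination of the `d j` whose weights are sums of squares of entries of `M`. By Abel
summation it suffices to bound the tail sums of these weights, which is `card_add_card_le_sum_sq`.
Existence is Williamson's theorem: split off symplectic planes on which the form is a multiple of
the identity, and induct on the orthogonal complement. -/

/-- Abel summation: a nonnegative monotone sequence pairs nonnegatively with every vector whose
tail sums are nonnegative. -/
theorem sum_mul_nonneg_of_tail_sums_nonneg {n : ℕ} {d x : Fin n → ℝ} (hd : Monotone d)
    (h0 : ∀ i, 0 ≤ d i) (hx : ∀ m : ℕ, 0 ≤ ∑ i ∈ Finset.univ.filter (fun i : Fin n => m ≤ (i : ℕ)), x i) :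
    0 ≤ ∑ i, d i * x i := by
  induction n with
  | zero => simp
  | succ n ih =>
    have h1 : 0 ≤ ∑ i : Fin n, (d i.succ - d 0) * x i.succ := by
      refine ih (d := fun i => d i.succ - d 0) (x := fun i => x i.succ) ?_ ?_ ?_
      · intro i j hij
        have := hd (Fin.succ_le_succ_iff.2 hij)
        simpa using this
      · intro i
        exact sub_nonneg.2 (hd (Fin.zero_le _))
      · intro m
        have h := hx (m + 1)
        rw [Finset.sum_filter, Fin.sum_univ_succ] at h
        rw [Finset.sum_filter]
        simpa using h
    have h2 : 0 ≤ ∑ i, x i := by simpa using hx 0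
    -- The constant part `d 0` pairs with the full sum; the remainder `d - d 0` vanishes at index 0
    -- and is again nonnegative and monotone.
    have h3 : ∑ i, d i * x i = d 0 * ∑ i, x i + ∑ i : Fin n, (d i.succ - d 0) * x i.succ := by
      simp only [Fin.sum_univ_succ, sub_mul, Finset.sum_sub_distrib, Finset.mul_sum, mul_add]
      ring
    rw [h3]
    exact add_nonneg (mul_nonneg (h0 0) h2) h1

/-! ### Bessel's inequality in coordinates. -/

section Bessel

variable {ι : Type*} [Fintype ι]

theorem bessel_dotProduct {κ : Type*} [Fintype κ] {v : κ → ι → ℝ}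
    (hv : Orthonormal ℝ fun a => WithLp.toLp 2 (v a)) (x : ι → ℝ) :
    ∑ a, (x ⬝ᵥ v a) ^ 2 ≤ x ⬝ᵥ x := by
  have h := hv.sum_inner_products_le (x := WithLp.toLp 2 x) (s := Finset.univ)
  rw [← real_inner_self_eq_norm_sq] at h
  simpa only [EuclideanSpace.inner_toLp_toLp, star_trivial, Real.norm_eq_abs, sq_abs] using h

theorem orthonormal_toLp_iff {κ : Type*} [DecidableEq κ] {v : κ → ι → ℝ} :
    Orthonormal ℝ (fun a => WithLp.toLp 2 (v a)) ↔
      ∀ a b, v a ⬝ᵥ v b = if a = b then 1 else 0 := by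
  rw [orthonormal_iff_ite]
  refine forall_congr' fun a => forall_congr' fun b => ?_
  simp [EuclideanSpace.inner_eq_star_dotProduct, dotProduct_comm]

theorem bessel_dotProduct_of_support [DecidableEq ι] {κ : Type*} [Fintype κ] {v : κ → ι → ℝ}
    (hv : Orthonormal ℝ fun a => WithLp.toLp 2 (v a)) {s : Finset ι}
    (hs : ∀ a, ∀ i ∉ s, v a i = 0) (x : ι → ℝ) :
    ∑ a, (x ⬝ᵥ v a) ^ 2 ≤ ∑ i ∈ s, x i ^ 2 := by
  have h := bessel_dotProduct hv fun i => if i ∈ s then x i else 0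
  have h1 : ∀ a, (fun i => if i ∈ s then x i else 0) ⬝ᵥ v a = x ⬝ᵥ v a := by
    intro a
    refine Finset.sum_congr rfl fun i _ => ?_
    by_cases hi : i ∈ s
    · simp [hi]
    · simp [hi, hs a i hi]
  have h2 : (fun i => if i ∈ s then x i else 0) ⬝ᵥ (fun i => if i ∈ s then x i else 0) =
      ∑ i ∈ s, x i ^ 2 := by
    simp [dotProduct, ← ite_and, sq]
  simpa only [h1, h2] using h

theorem exists_orthonormal_of_le_finrank (V : Submodule ℝ (ι → ℝ)) :
    ∃ v : Fin (Module.finrank ℝ V) → ι → ℝ,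
      (∀ a, v a ∈ V) ∧ Orthonormal ℝ fun a => WithLp.toLp 2 (v a) := by
  let e := (WithLp.linearEquiv 2 ℝ (ι → ℝ)).symm
  let W : Submodule ℝ (EuclideanSpace ℝ ι) := V.map e.toLinearMap
  have hW : Module.finrank ℝ W = Module.finrank ℝ V := LinearEquiv.finrank_map_eq e V
  let b := (stdOrthonormalBasis ℝ W).reindex (finCongr hW)
  refine ⟨fun a => WithLp.ofLp (b a : EuclideanSpace ℝ ι), fun a => ?_, ?_⟩
  · obtain ⟨y, hy, h⟩ := (b a).2
    have h' : WithLp.ofLp (b a : EuclideanSpace ℝ ι) = y := by rw [← h]; rfl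
    change WithLp.ofLp (b a : EuclideanSpace ℝ ι) ∈ V
    rw [h']
    exact hy
  · exact b.orthonormal.comp_linearIsometry W.subtypeₗᵢ

end Bessel

/-! ### Lower bounds for sums of squares over blocks of a symplectic matrix. -/

section Superstochastic

variable {n : ℕ}

/-- `V` is cut out of a space of dimension `2 * n` by one linear equation for each index outside `S`
and each index outside `T`. -/
theorem two_card_add_card_le (M : Matrix (Fin n ⊕ Fin n) (Fin n ⊕ Fin n) ℝ)
    (S T : Finset (Fin n ⊕ Fin n)) :
    ∃ V : Submodule ℝ (Fin n ⊕ Fin n → ℝ), S.card + T.card ≤ Module.finrank ℝ V + 2 * n ∧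
      ∀ x ∈ V, (∀ i ∉ S, x i = 0) ∧ ∀ j ∉ T, (M *ᵥ x) j = 0 := by
  let g : (Fin n ⊕ Fin n → ℝ) →ₗ[ℝ] (((Sᶜ : Finset _) → ℝ) × ((Tᶜ : Finset _) → ℝ)) :=
    (LinearMap.funLeft ℝ ℝ Subtype.val).prod (LinearMap.funLeft ℝ ℝ Subtype.val ∘ₗ M.mulVecLin)
  refine ⟨LinearMap.ker g, ?_, ?_⟩
  · have h1 := g.finrank_range_add_finrank_ker
    have h2 := (LinearMap.range g).finrank_le
    have h3 := S.card_add_card_compl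
    have h4 := T.card_add_card_compl
    simp only [Module.finrank_prod, Module.finrank_fintype_fun_eq_card, Fintype.card_coe,
      Fintype.card_sum, Fintype.card_fin] at h1 h2 h3 h4
    omega
  · intro x hx
    have hx' : g x = 0 := hx
    refine ⟨fun i hi => ?_, fun j hj => ?_⟩
    · exact congrFun (congrArg Prod.fst hx') ⟨i, by simpa using hi⟩
    · exact congrFun (congrArg Prod.snd hx') ⟨j, by simpa using hj⟩

theorem J_mulVec_dotProduct_J_mulVec (x y : Fin n ⊕ Fin n → ℝ) :
    (J (Fin n) ℝ *ᵥ x) ⬝ᵥ (J (Fin n) ℝ *ᵥ y) = x ⬝ᵥ y := by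
  rw [dotProduct_mulVec, ← mulVec_transpose, mulVec_mulVec, J_transpose, neg_mul, J_squared]
  simp

theorem J_mulVec_inl (x : Fin n ⊕ Fin n → ℝ) (i : Fin n) :
    (J (Fin n) ℝ *ᵥ x) (Sum.inl i) = -x (Sum.inr i) := by
  simp [J, fromBlocks_mulVec, neg_mulVec]

theorem J_mulVec_inr (x : Fin n ⊕ Fin n → ℝ) (i : Fin n) :
    (J (Fin n) ℝ *ᵥ x) (Sum.inr i) = x (Sum.inl i) := by
  simp [J, fromBlocks_mulVec]

/-- Up to sign `J` swaps the two coordinates of each pair, so supports made of whole pairs are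
preserved. -/
theorem J_mulVec_eq_zero_of_notMem {S : Finset (Fin n)} {x : Fin n ⊕ Fin n → ℝ}
    (hx : ∀ i ∉ S.disjSum S, x i = 0) :
    ∀ i ∉ S.disjSum S, (J (Fin n) ℝ *ᵥ x) i = 0 := by
  rintro (i | i) hi
  · rw [J_mulVec_inl, hx _ (by simpa using hi), neg_zero]
  · rw [J_mulVec_inr, hx _ (by simpa using hi)]

/-- The matrix of sums of squares of the `2 × 2` blocks of a symplectic matrix is doubly
superstochastic (up to the factor two). -/
theorem card_add_card_le_sum_sq {M : Matrix (Fin n ⊕ Fin n) (Fin n ⊕ Fin n) ℝ}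
    (hM : M ∈ symplecticGroup (Fin n) ℝ) (S T : Finset (Fin n)) :
    2 * (S.card : ℝ) + 2 * T.card ≤
      ∑ j ∈ T.disjSum T, ∑ i ∈ S.disjSum S, M j i ^ 2 + 2 * n := by
  obtain ⟨V, hV, hVx⟩ := two_card_add_card_le M (S.disjSum S) (T.disjSum T)
  obtain ⟨v, hvV, hv⟩ := exists_orthonormal_of_le_finrank V
  set Jn := J (Fin n) ℝ
  have hJv : Orthonormal ℝ fun a => WithLp.toLp 2 (Jn *ᵥ v a) := by
    rw [orthonormal_toLp_iff] at hv ⊢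
    simpa only [Jn, J_mulVec_dotProduct_J_mulVec] using hv
  -- Since `Mᵀ J M = J`, the vectors `M J v` and `J M v` have inner product 1 for a unit vector `v`.
  -- The second is supported on the pairs in `T`, so `2xy ≤ x² + y²` gives the bound. Summing over
  -- `a` and applying Bessel to each row of `M`, once with `v` and once with `J v`, bounds the
  -- dimension of `V` by the block sum.
  have key : ∀ a, 2 ≤ ∑ j ∈ T.disjSum T, ((M j ⬝ᵥ v a) ^ 2 + (M j ⬝ᵥ (Jn *ᵥ v a)) ^ 2) := by
    intro a
    have hsupp := J_mulVec_eq_zero_of_notMem (hVx _ (hvV a)).2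
    have h1 : (M *ᵥ (Jn *ᵥ v a)) ⬝ᵥ (Jn *ᵥ (M *ᵥ v a)) = 1 := by
      have : (M *ᵥ (Jn *ᵥ v a)) ⬝ᵥ (Jn *ᵥ (M *ᵥ v a)) = (Jn *ᵥ v a) ⬝ᵥ ((Mᵀ * Jn * M) *ᵥ v a) := by
        rw [← mulVec_mulVec, ← mulVec_mulVec, dotProduct_mulVec (Jn *ᵥ v a), vecMul_transpose]
      rw [this, SymplecticGroup.mem_iff'.1 hM, J_mulVec_dotProduct_J_mulVec,
        orthonormal_toLp_iff.1 hv a a, if_pos rfl]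
    have h2 : (M *ᵥ (Jn *ᵥ v a)) ⬝ᵥ (Jn *ᵥ (M *ᵥ v a)) =
        ∑ j ∈ T.disjSum T, (M j ⬝ᵥ (Jn *ᵥ v a)) * (Jn *ᵥ (M *ᵥ v a)) j :=
      (Finset.sum_subset (Finset.subset_univ _) fun j _ hj => by rw [hsupp j hj, mul_zero]).symm
    have h3 : ∑ j ∈ T.disjSum T, (M j ⬝ᵥ v a) ^ 2 =
        ∑ j ∈ T.disjSum T, (Jn *ᵥ (M *ᵥ v a)) j ^ 2 := by
      simp only [Finset.sum_disjSum, Jn, J_mulVec_inl, J_mulVec_inr, neg_sq]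
      exact add_comm _ _
    rw [Finset.sum_add_distrib, h3, ← Finset.sum_add_distrib, ← mul_one 2, ← h1, h2,
      Finset.mul_sum]
    refine Finset.sum_le_sum fun j _ => ?_
    nlinarith [sq_nonneg (M j ⬝ᵥ (Jn *ᵥ v a) - (Jn *ᵥ (M *ᵥ v a)) j)]
  have h4 : ∑ a, ∑ j ∈ T.disjSum T, ((M j ⬝ᵥ v a) ^ 2 + (M j ⬝ᵥ (Jn *ᵥ v a)) ^ 2) ≤
      ∑ j ∈ T.disjSum T, 2 * ∑ i ∈ S.disjSum S, M j i ^ 2 := by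
    rw [Finset.sum_comm]
    refine Finset.sum_le_sum fun j _ => ?_
    rw [Finset.sum_add_distrib, two_mul]
    exact add_le_add (bessel_dotProduct_of_support hv (fun a => (hVx _ (hvV a)).1) _)
      (bessel_dotProduct_of_support hJv
        (fun a => J_mulVec_eq_zero_of_notMem (hVx _ (hvV a)).1) _)
  have h5 := (Finset.sum_le_sum fun a (_ : a ∈ Finset.univ) => key a).trans h4
  rw [← Finset.mul_sum] at h5
  simp only [Finset.sum_const, Finset.card_univ, Fintype.card_fin, nsmul_eq_mul,
    Finset.card_disjSum] at h5 hV
  have h6 : (S.card : ℝ) + S.card + (T.card + T.card) ≤ Module.finrank ℝ V + 2 * n := by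
    exact_mod_cast hV
  linarith

end Superstochastic

/-! ### Variational bound for partial traces, majorization and uniqueness. -/

section PartialTrace

variable {n : ℕ}

/-- The partial trace of `Mᵀ X M` over the index pairs in `S`, as a linear function of `X`. -/
noncomputable def partialTrace (S : Finset (Fin n))
    (M : Matrix (Fin n ⊕ Fin n) (Fin n ⊕ Fin n) ℝ) :
    Matrix (Fin n ⊕ Fin n) (Fin n ⊕ Fin n) ℝ →ₗ[ℝ] ℝ where
  toFun X := ∑ i ∈ S.disjSum S, (Mᵀ * X * M) i i
  map_add' X Y := by simp [mul_add, add_mul, Finset.sum_add_distrib]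
  map_smul' c X := by simp [Finset.mul_sum, mul_add]

theorem partialTrace_apply (S : Finset (Fin n)) (M X : Matrix (Fin n ⊕ Fin n) (Fin n ⊕ Fin n) ℝ) :
    partialTrace S M X = ∑ i ∈ S.disjSum S, (Mᵀ * X * M) i i := rfl

theorem partialTrace_congr (S : Finset (Fin n))
    (M N X : Matrix (Fin n ⊕ Fin n) (Fin n ⊕ Fin n) ℝ) :
    partialTrace S M (Nᵀ * X * N) = partialTrace S (N * M) X := by
  simp only [partialTrace_apply, transpose_mul, Matrix.mul_assoc]

theorem partialTrace_of_eq_diagonal {S : Finset (Fin n)}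
    {M X : Matrix (Fin n ⊕ Fin n) (Fin n ⊕ Fin n) ℝ} {d : Fin n → ℝ}
    (h : Mᵀ * X * M = fromBlocks (diagonal d) 0 0 (diagonal d)) :
    partialTrace S M X = 2 * ∑ i ∈ S, d i := by
  simp [partialTrace_apply, h, Finset.sum_disjSum, two_mul]

theorem partialTrace_diagonal (S : Finset (Fin n))
    (M : Matrix (Fin n ⊕ Fin n) (Fin n ⊕ Fin n) ℝ) (d : Fin n → ℝ) :
    partialTrace S M (fromBlocks (diagonal d) 0 0 (diagonal d)) =
      ∑ j, d j * ∑ i ∈ S.disjSum S, (M (Sum.inl j) i ^ 2 + M (Sum.inr j) i ^ 2) := by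
  rw [fromBlocks_diagonal]
  have h : ∀ i, (Mᵀ * diagonal (Sum.elim d d) * M) i i =
      ∑ j, d j * (M (Sum.inl j) i ^ 2 + M (Sum.inr j) i ^ 2) := by
    intro i
    rw [mul_apply, Fintype.sum_sum_type, ← Finset.sum_add_distrib]
    refine Finset.sum_congr rfl fun j _ => ?_
    simp only [mul_diagonal, transpose_apply, Sum.elim_inl, Sum.elim_inr]
    ring
  simp only [partialTrace_apply, h, Finset.mul_sum]
  exact Finset.sum_comm

theorem two_sum_le_partialTrace_diagonal {M : Matrix (Fin n ⊕ Fin n) (Fin n ⊕ Fin n) ℝ}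
    (hM : M ∈ symplecticGroup (Fin n) ℝ) {d : Fin n → ℝ} (hd : Monotone d) (h0 : ∀ i, 0 ≤ d i)
    (k : Fin n) :
    2 * ∑ i ∈ Finset.Iic k, d i ≤
      partialTrace (Finset.Iic k) M (fromBlocks (diagonal d) 0 0 (diagonal d)) := by
  set w : Fin n → ℝ := fun j =>
    ∑ i ∈ (Finset.Iic k).disjSum (Finset.Iic k), (M (Sum.inl j) i ^ 2 + M (Sum.inr j) i ^ 2)
    with hw
  have hw0 : ∀ j, 0 ≤ w j := fun j => Finset.sum_nonneg fun i _ => by positivity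
  have h := sum_mul_nonneg_of_tail_sums_nonneg
    (x := fun j => w j - if j ≤ k then 2 else 0) hd h0 ?_
  · rw [partialTrace_diagonal]
    simp only [mul_sub, Finset.sum_sub_distrib, mul_ite, mul_zero] at h
    rw [← Finset.sum_filter, Finset.filter_ge_eq_Iic, ← Finset.sum_mul] at h
    linarith
  · intro m
    rw [Finset.sum_sub_distrib, sub_nonneg, ← Finset.sum_filter, Finset.filter_filter,
      Finset.sum_const, nsmul_eq_mul]
    -- With `k + 1` column pairs and `n - m` row pairs, the superstochastic bound is `2 * (k + 1 -
    -- m)`, exactly twice the number of `j` with `m ≤ j ≤ k`.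
    rcases le_or_gt m (k : ℕ) with hm | hm
    · have h1 := card_add_card_le_sum_sq hM (Finset.Iic k)
        (Finset.univ.filter fun j : Fin n => m ≤ (j : ℕ))
      rw [Finset.sum_disjSum, ← Finset.sum_add_distrib] at h1
      simp only [← Finset.sum_add_distrib] at h1
      have h2 : (Finset.univ.filter fun j : Fin n => m ≤ (j : ℕ)) = Finset.Ici ⟨m, by omega⟩ := by
        ext j; simp only [Finset.mem_filter, Finset.mem_univ, true_and, Finset.mem_Ici, Fin.le_def]
      have h3 : (Finset.univ.filter fun j : Fin n => m ≤ (j : ℕ) ∧ j ≤ k) =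
          Finset.Icc ⟨m, by omega⟩ k := by
        ext j; simp only [Finset.mem_filter, Finset.mem_univ, true_and, Finset.mem_Icc, Fin.le_def]
      rw [h2, Fin.card_Iic, Fin.card_Ici] at h1
      rw [h2, h3, Fin.card_Icc]
      simp only at h1 ⊢
      rw [Nat.cast_sub (by omega)] at h1 ⊢
      push_cast at h1 ⊢
      linarith
    · have : (Finset.univ.filter fun j : Fin n => m ≤ (j : ℕ) ∧ j ≤ k) = ∅ := by
        ext j
        simp only [Finset.mem_filter, Finset.mem_univ, true_and, Finset.notMem_empty, iff_false,
          Fin.le_def]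
        omega
      rw [this]
      simpa using Finset.sum_nonneg fun j _ => hw0 j

/-- Writing `M = N * (N⁻¹ * M)`, with `N` diagonalizing `X`, reduces this to the diagonal case. -/
theorem IsSymplecticSpectrum.two_sum_le_partialTrace
    {X M : Matrix (Fin n ⊕ Fin n) (Fin n ⊕ Fin n) ℝ} {d : Fin n → ℝ}
    (hd : IsSymplecticSpectrum X d) (hM : M ∈ symplecticGroup (Fin n) ℝ) (k : Fin n) :
    2 * ∑ i ∈ Finset.Iic k, d i ≤ partialTrace (Finset.Iic k) M X := by
  obtain ⟨hmono, h0, N, hN, hNX⟩ := hd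
  let g : symplecticGroup (Fin n) ℝ := ⟨N, hN⟩
  have hg : N * (g⁻¹).1 = 1 := congrArg Subtype.val (mul_inv_cancel g)
  have h := two_sum_le_partialTrace_diagonal (Submonoid.mul_mem _ (g⁻¹).2 hM) hmono h0 k
  rwa [← hNX, partialTrace_congr, ← Matrix.mul_assoc, hg, Matrix.one_mul] at h

theorem IsSymplecticSpectrum.sum_le_of_mem_convexHull
    {A B : Matrix (Fin n ⊕ Fin n) (Fin n ⊕ Fin n) ℝ} {a b : Fin n → ℝ}
    (ha : IsSymplecticSpectrum A a) (hb : IsSymplecticSpectrum B b)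
    (hAB : A ∈ convexHull ℝ (symplecticOrbit B)) (k : Fin n) :
    ∑ i ∈ Finset.Iic k, b i ≤ ∑ i ∈ Finset.Iic k, a i := by
  obtain ⟨-, -, M, hM, hMA⟩ := ha
  have h : convexHull ℝ (symplecticOrbit B) ⊆
      {X | 2 * ∑ i ∈ Finset.Iic k, b i ≤ partialTrace (Finset.Iic k) M X} := by
    refine convexHull_min ?_ (convex_halfSpace_ge (partialTrace (Finset.Iic k) M).isLinear _)
    rintro _ ⟨N, hN, rfl⟩
    rw [Set.mem_ofPred_eq, partialTrace_congr]
    exact hb.two_sum_le_partialTrace (mul_mem hN hM) k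
  have h1 : 2 * ∑ i ∈ Finset.Iic k, b i ≤ partialTrace (Finset.Iic k) M A := h hAB
  rw [partialTrace_of_eq_diagonal hMA] at h1
  linarith

theorem eq_of_forall_sum_Iic_eq {a b : Fin n → ℝ}
    (h : ∀ k, ∑ i ∈ Finset.Iic k, a i = ∑ i ∈ Finset.Iic k, b i) : a = b := by
  funext k
  induction k using WellFoundedLT.induction with
  | ind k ih =>
    have h1 := h k
    rw [← Finset.Iio_insert, Finset.sum_insert (by simp), Finset.sum_insert (by simp),
      Finset.sum_congr rfl fun i hi => ih i (Finset.mem_Iio.1 hi)] at h1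
    exact add_right_cancel h1

theorem IsSymplecticSpectrum.unique {A : Matrix (Fin n ⊕ Fin n) (Fin n ⊕ Fin n) ℝ}
    {a b : Fin n → ℝ} (ha : IsSymplecticSpectrum A a) (hb : IsSymplecticSpectrum A b) : a = b := by
  have hA : A ∈ convexHull ℝ (symplecticOrbit A) :=
    subset_convexHull ℝ _ ⟨1, one_mem _, by simp⟩
  exact eq_of_forall_sum_Iic_eq fun k =>
    (hb.sum_le_of_mem_convexHull ha hA k).antisymm (ha.sum_le_of_mem_convexHull hb hA k)

theorem isSymplecticSpectrum_symplecticEigenvalues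
    {A : Matrix (Fin n ⊕ Fin n) (Fin n ⊕ Fin n) ℝ} (h : ∃ d, IsSymplecticSpectrum A d) :
    IsSymplecticSpectrum A (symplecticEigenvalues A) := by
  rw [symplecticEigenvalues, dif_pos h]
  exact h.choose_spec

theorem sortedIncreasing_eq_self {x : Fin n → ℝ} (hx : Monotone x) : sortedIncreasing x = x := by
  rw [sortedIncreasing, Tuple.sort_eq_refl_iff_monotone.2 hx]
  rfl

end PartialTrace

/-! ### Williamson normal form. -/

section Williamson

open Module

/-- A symmetric operator for a positive definite form has a real eigenvector. -/
theorem exists_eigenvector_of_symmetric {V : Type*} [AddCommGroup V] [Module ℝ V]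
    [FiniteDimensional ℝ V] [Nontrivial V] (q : V →ₗ[ℝ] V →ₗ[ℝ] ℝ) (hq : ∀ x y, q x y = q y x)
    (hpos : ∀ x, 0 ≤ q x x) (hdef : ∀ x, q x x = 0 → x = 0) (T : V →ₗ[ℝ] V)
    (hT : ∀ x y, q (T x) y = q x (T y)) : ∃ (c : ℝ) (x : V), x ≠ 0 ∧ T x = c • x := by
  let core : InnerProductSpace.Core ℝ V :=
    { inner := fun x y => q x y
      conj_inner_symm := fun x y => by simpa using hq y x
      re_inner_nonneg := fun x => by simpa using hpos x
      definite := hdef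
      add_left := fun x y z => by simp
      smul_left := fun x y r => by simp }
  let _ : NormedAddCommGroup V := core.toNormedAddCommGroup
  let _ : InnerProductSpace ℝ V := InnerProductSpace.ofCore core.toCore
  have hsymm : T.IsSymmetric := hT
  obtain ⟨x, hx⟩ := hsymm.hasEigenvalue_iSup_of_finiteDimensional.exists_hasEigenvector
  exact ⟨_, x, hx.2, hx.apply_eq_smul⟩

variable {V : Type*} [AddCommGroup V] [Module ℝ V]

/-- The operator `L` with `ω x (L y) = q x y` is skew for `q`, so `L²` is `q`-symmetric with
negative eigenvalues. An eigenvector `x` of `L²` spans with `L x` an `L`-invariant plane, and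
rescaling these two vectors gives the pair. -/
theorem exists_williamson_pair_of_posDef [FiniteDimensional ℝ V] [Nontrivial V]
    (ω q : V →ₗ[ℝ] V →ₗ[ℝ] ℝ) (hω : ∀ x y, ω x y = -ω y x) (hnd : ∀ x ≠ 0, ∃ y, ω x y ≠ 0)
    (hq : ∀ x y, q x y = q y x) (hpos : ∀ x, 0 ≤ q x x) (hdef : ∀ x, q x x = 0 → x = 0) :
    ∃ (e f : V) (c : ℝ), 0 ≤ c ∧ ω e f = 1 ∧
      (∀ z, q z e = c * ω z f) ∧ ∀ z, q z f = -(c * ω z e) := by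
  have hinj : Function.Injective ω.flip := by
    rw [injective_iff_map_eq_zero]
    intro x hx
    by_contra hne
    obtain ⟨y, hy⟩ := hnd x hne
    apply hy
    rw [hω, ← LinearMap.flip_apply, hx]
    simp
  let E := LinearEquiv.ofInjectiveOfFinrankEq ω.flip hinj (Subspace.dual_finrank_eq).symm
  let L : V →ₗ[ℝ] V := E.symm.toLinearMap ∘ₗ q.flip
  have hL : ∀ x y, ω x (L y) = q x y := by
    intro x y
    have h : E (L y) = q.flip y := E.apply_symm_apply _
    exact LinearMap.congr_fun h x
  have hskew : ∀ x y, q (L x) y = -q x (L y) := by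
    intro x y
    rw [← hL, hω, hL, hq]
  obtain ⟨ν, x, hx, hν⟩ := exists_eigenvector_of_symmetric q hq hpos hdef (L ∘ₗ L)
    (fun x y => by simp [hskew])
  simp only [LinearMap.comp_apply] at hν
  have hqx : 0 < q x x := (hpos x).lt_of_ne fun h => hx (hdef x h.symm)
  have hLx : L x ≠ 0 := by
    intro h
    rw [← hL, h, map_zero] at hqx
    exact lt_irrefl _ hqx
  have hqLx : 0 < q (L x) (L x) := (hpos _).lt_of_ne fun h => hLx (hdef _ h.symm)
  have hν0 : 0 < -ν := by
    rw [hskew, hν, map_smul, smul_eq_mul] at hqLx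
    by_contra h
    nlinarith
  obtain ⟨c, hc, hcν⟩ : ∃ c : ℝ, 0 < c ∧ c * c = -ν :=
    ⟨√(-ν), Real.sqrt_pos.2 hν0, Real.mul_self_sqrt hν0.le⟩
  -- This scale makes `ω e f = q x x / (c * s²)` equal to 1.
  obtain ⟨s, hs, hss⟩ : ∃ s : ℝ, 0 < s ∧ s * s = q x x / c :=
    ⟨√(q x x / c), Real.sqrt_pos.2 (div_pos hqx hc), Real.mul_self_sqrt (div_pos hqx hc).le⟩
  have hss' : q x x = s * s * c := by rw [hss]; field_simp
  refine ⟨s⁻¹ • x, (c⁻¹ * s⁻¹) • L x, c, hc.le, ?_, fun z => ?_, fun z => ?_⟩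
  · simp only [map_smul, LinearMap.smul_apply, smul_eq_mul, hL, hss']
    field_simp
  · simp only [map_smul, smul_eq_mul, hL]
    field_simp
  · simp only [map_smul, smul_eq_mul]
    rw [← hL, hν, map_smul, smul_eq_mul, ← neg_neg ν, ← hcν]
    field_simp

/-- If `q` is degenerate, a kernel vector and a partner in the symplectic kernel form a pair with `c
= 0`; otherwise `q` is positive definite. -/
theorem exists_williamson_pair [FiniteDimensional ℝ V] [Nontrivial V]
    (ω q : V →ₗ[ℝ] V →ₗ[ℝ] ℝ) (hω : ∀ x y, ω x y = -ω y x) (hnd : ∀ x ≠ 0, ∃ y, ω x y ≠ 0)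
    (hq : ∀ x y, q x y = q y x) (hpos : ∀ x, 0 ≤ q x x)
    (hker : ∀ x ≠ 0, (∀ z, q z x = 0) → ∃ y, (∀ z, q z y = 0) ∧ ω x y ≠ 0) :
    ∃ (e f : V) (c : ℝ), 0 ≤ c ∧ ω e f = 1 ∧
      (∀ z, q z e = c * ω z f) ∧ ∀ z, q z f = -(c * ω z e) := by
  by_cases h : ∃ x ≠ 0, ∀ z, q z x = 0
  · obtain ⟨x, hx, hxz⟩ := h
    obtain ⟨y, hy, hxy⟩ := hker x hx hxz
    refine ⟨x, (ω x y)⁻¹ • y, 0, le_rfl, ?_, ?_, ?_⟩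
    · simp [hxy]
    · simpa using hxz
    · simp [hy]
  · refine exists_williamson_pair_of_posDef ω q hω hnd hq hpos fun x hx => ?_
    by_contra hne
    refine h ⟨x, hne, fun z => ?_⟩
    by_contra hzx
    -- If `q x x = 0` but `q z x ≠ 0`, this `t` makes `q (z + t • x) (z + t • x) = -q z z - 2`,
    -- which is negative.
    obtain ⟨t, ht⟩ : ∃ t : ℝ, t * q z x = -(q z z + 1) :=
      ⟨-(q z z + 1) / q z x, div_mul_cancel₀ _ hzx⟩
    have h1 := hpos (z + t • x)
    simp only [map_add, LinearMap.add_apply, map_smul, LinearMap.smul_apply, smul_eq_mul, hx,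
      hq x z, ht] at h1
    linarith [hpos z]

/-- Williamson's normal form for a positive semidefinite form with symplectic kernel on a
finite-dimensional symplectic space. -/
theorem exists_williamson_basis (N : ℕ) : ∀ (V : Type) [AddCommGroup V] [Module ℝ V]
    [FiniteDimensional ℝ V] (_ : finrank ℝ V = N) (ω q : V →ₗ[ℝ] V →ₗ[ℝ] ℝ)
    (_ : ∀ x y, ω x y = -ω y x) (_ : ∀ x ≠ 0, ∃ y, ω x y ≠ 0)
    (_ : ∀ x y, q x y = q y x) (_ : ∀ x, 0 ≤ q x x)
    (_ : ∀ x ≠ 0, (∀ z, q z x = 0) → ∃ y, (∀ z, q z y = 0) ∧ ω x y ≠ 0),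
    ∃ (m : ℕ) (e f : Fin m → V) (d : Fin m → ℝ), 2 * m = N ∧ (∀ i, 0 ≤ d i) ∧
      (∀ i j, ω (e i) (e j) = 0) ∧ (∀ i j, ω (f i) (f j) = 0) ∧
      (∀ i j, ω (e i) (f j) = if i = j then 1 else 0) ∧
      (∀ i j, q (e i) (e j) = if i = j then d i else 0) ∧
      (∀ i j, q (f i) (f j) = if i = j then d i else 0) ∧
      (∀ i j, q (e i) (f j) = 0) := by
  induction N using Nat.strong_induction_on with
  | _ N ih =>
  intro V _ _ _ hN ω q hω hnd hq hpos hker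
  rcases subsingleton_or_nontrivial V with hV | hV
  · refine ⟨0, fun _ => 0, fun _ => 0, fun _ => 0, ?_, ?_⟩
    · rw [← hN, finrank_zero_of_subsingleton]
    · exact ⟨fun i => i.elim0, fun i => i.elim0, fun i => i.elim0, fun i => i.elim0,
        fun i => i.elim0, fun i => i.elim0, fun i => i.elim0⟩
  obtain ⟨e, f, c, hc, hef, hqe, hqf⟩ := exists_williamson_pair ω q hω hnd hq hpos hker
  have hself : ∀ x, ω x x = 0 := fun x => by linarith [hω x x]
  have hfe : ω f e = -1 := by rw [hω, hef]
  let g : V →ₗ[ℝ] ℝ × ℝ := (ω e).prod (ω f)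
  -- `W` is the `ω`-complement of the plane of `e` and `f`; by `hqe` and `hqf` it is also
  -- `q`-orthogonal to that plane. Projecting onto `W` therefore changes neither pairing against
  -- `W`, and all hypotheses descend to it.
  let W : Submodule ℝ V := LinearMap.ker g
  have hW : ∀ {x}, x ∈ W ↔ ω e x = 0 ∧ ω f x = 0 := fun {x} => by
    simp [W, g]
  have hgs : LinearMap.range g = ⊤ := by
    rw [LinearMap.range_eq_top]
    rintro ⟨a, b⟩
    refine ⟨a • f - b • e, ?_⟩
    simp [g, hself, hef, hfe]
  have hrank : finrank ℝ W + 2 = N := by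
    have h := g.finrank_range_add_finrank_ker
    rw [hgs, finrank_top, finrank_prod, finrank_self, hN] at h
    change _ + finrank ℝ W = _ at h
    omega
  have heW : ∀ x : W, ω e x = 0 := fun x => (hW.1 x.2).1
  have hfW : ∀ x : W, ω f x = 0 := fun x => (hW.1 x.2).2
  have hWe : ∀ x : W, ω x e = 0 := fun x => by rw [hω, heW, neg_zero]
  have hWf : ∀ x : W, ω x f = 0 := fun x => by rw [hω, hfW, neg_zero]
  have hqWe : ∀ x : W, q x e = 0 := fun x => by rw [hqe, hWf, mul_zero]
  have hqWf : ∀ x : W, q x f = 0 := fun x => by rw [hqf, hWe, mul_zero, neg_zero]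
  have hproj : ∀ y : V, ∃ w : W, (w : V) = y - ω y f • e + ω y e • f := fun y => by
    refine ⟨⟨_, hW.2 ⟨?_, ?_⟩⟩, rfl⟩
    · simp [hself, hef, hω e y]
    · simp [hself, hfe, hω f y]
  have hωproj : ∀ (x w : W) (y : V), (w : V) = y - ω y f • e + ω y e • f → ω x w = ω x y := by
    intro x w y h
    simp [h, hWe, hWf]
  have hqproj : ∀ (x w : W) (y : V), (w : V) = y - ω y f • e + ω y e • f → q x w = q x y := by
    intro x w y h
    simp [h, hqWe, hqWf]
  obtain ⟨m, e', f', d, hm, hd, h1, h2, h3, h4, h5, h6⟩ := ih (finrank ℝ W) (by omega) W rfl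
    (ω.domRestrict₁₂ W W) (q.domRestrict₁₂ W W) (fun x y => hω x y)
    (by
      intro x hx
      obtain ⟨y, hy⟩ := hnd x (by simpa using hx)
      obtain ⟨w, hw⟩ := hproj y
      refine ⟨w, ?_⟩
      rw [LinearMap.domRestrict₁₂_apply, hωproj x w y hw]
      exact hy)
    (fun x y => hq x y) (fun x => hpos x)
    (by
      intro x hx hxq
      obtain ⟨y, hy, hxy⟩ := hker x (by simpa using hx) (by
        intro z
        obtain ⟨w, hw⟩ := hproj z
        rw [hq, ← hqproj x w z hw, hq]
        exact hxq w)
      obtain ⟨w, hw⟩ := hproj y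
      refine ⟨w, fun z => ?_, ?_⟩
      · rw [LinearMap.domRestrict₁₂_apply, hqproj z w y hw, hy]
      · rw [LinearMap.domRestrict₁₂_apply, hωproj x w y hw]
        exact hxy)
  simp only [LinearMap.domRestrict₁₂_apply] at h1 h2 h3 h4 h5 h6
  have hqee : q e e = c := by rw [hqe, hef, mul_one]
  have hqff : q f f = c := by rw [hqf, hfe]; ring
  have hqef : q e f = 0 := by rw [hqf, hself]; ring
  have hqeW : ∀ x : W, q e x = 0 := fun x => by rw [hq, hqWe]
  have hqfW : ∀ x : W, q f x = 0 := fun x => by rw [hq, hqWf]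
  refine ⟨m + 1, Fin.cons e fun i => e' i, Fin.cons f fun i => f' i, Fin.cons c d, by omega,
    ?_, ?_, ?_, ?_, ?_, ?_, ?_⟩
  · exact Fin.cases hc hd
  all_goals
    refine Fin.cases (Fin.cases ?_ fun j => ?_) fun i => Fin.cases ?_ fun j => ?_
  all_goals
    simp [hself, hef, heW, hfW, hWe, hWf, hqWe, hqWf, hqeW, hqfW, hqee, hqff, hqef,
      h1, h2, h3, h4, h5, h6, Fin.succ_ne_zero, (Fin.succ_ne_zero _).symm]

end Williamson

/-! ### Matrix form of Williamson's theorem and the conclusion. -/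

theorem Matrix.PosSemidef.exists_isSymplecticSpectrum {n : ℕ}
    {A : Matrix (Fin n ⊕ Fin n) (Fin n ⊕ Fin n) ℝ} (hA : A.PosSemidef)
    (hk : HasSymplecticKernel A) : ∃ d, IsSymplecticSpectrum A d := by
  set Jn := J (Fin n) ℝ with hJn
  -- The sign matches `ω (e i) (f i) = 1` with the upper right block `-1` of `J`.
  let ω : (Fin n ⊕ Fin n → ℝ) →ₗ[ℝ] (Fin n ⊕ Fin n → ℝ) →ₗ[ℝ] ℝ := Matrix.toLinearMap₂' ℝ (-Jn)
  let q : (Fin n ⊕ Fin n → ℝ) →ₗ[ℝ] (Fin n ⊕ Fin n → ℝ) →ₗ[ℝ] ℝ := Matrix.toLinearMap₂' ℝ A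
  have hωa : ∀ x y, ω x y = -(x ⬝ᵥ (Jn *ᵥ y)) := fun x y => by
    simp [ω, Matrix.toLinearMap₂'_apply']
  have hqa : ∀ x y, q x y = x ⬝ᵥ (A *ᵥ y) := fun x y => by
    simp [q, Matrix.toLinearMap₂'_apply']
  have hsymm : Aᵀ = A := by simpa using hA.1.eq
  have hkerq : ∀ x, A *ᵥ x = 0 ↔ ∀ z, q z x = 0 := fun x => by
    simp only [hqa]
    constructor
    · intro h z
      rw [h, dotProduct_zero]
    · exact fun h => dotProduct_eq_zero _ (fun z => by rw [dotProduct_comm]; exact h z)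
  obtain ⟨m, e, f, d, hm, hd, h1, h2, h3, h4, h5, h6⟩ := exists_williamson_basis (2 * n)
    (Fin n ⊕ Fin n → ℝ) (by simp [two_mul]) ω q
    (fun x y => by
      rw [hωa, hωa, dotProduct_mulVec, ← mulVec_transpose, J_transpose, dotProduct_comm]
      simp [neg_mulVec, hJn])
    (fun x hx => ⟨Jn *ᵥ x, by
      rw [hωa, mulVec_mulVec, hJn, J_squared]
      simpa [neg_mulVec] using hx⟩)
    (fun x y => by
      rw [hqa, hqa, dotProduct_mulVec, ← mulVec_transpose, hsymm, dotProduct_comm])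
    (fun x => by
      rw [hqa]
      simpa using hA.dotProduct_mulVec_nonneg x)
    (fun x hx hxq => by
      obtain ⟨v, hv, hxv⟩ := hk x ((hkerq x).2 hxq) hx
      exact ⟨v, (hkerq v).1 hv, by rw [hωa]; exact neg_ne_zero.2 hxv⟩)
  obtain rfl : m = n := by omega
  -- Permuting the `e i` and the `f i` simultaneously sorts the spectrum and keeps the basis
  -- symplectic.
  let σ := Tuple.sort d
  let M : Matrix (Fin m ⊕ Fin m) (Fin m ⊕ Fin m) ℝ :=
    Matrix.of fun a b => Sum.elim (fun i => e (σ i)) (fun i => f (σ i)) b a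
  have hentry : ∀ (X : Matrix (Fin m ⊕ Fin m) (Fin m ⊕ Fin m) ℝ) i j, (Mᵀ * X * M) i j =
      Mᵀ i ⬝ᵥ (X *ᵥ Mᵀ j) := fun X i j => by
    rw [Matrix.mul_assoc, mul_apply']
    rfl
  have hl : ∀ i, Mᵀ (Sum.inl i) = e (σ i) := fun i => rfl
  have hr : ∀ i, Mᵀ (Sum.inr i) = f (σ i) := fun i => rfl
  simp only [hωa, neg_eq_iff_eq_neg] at h1 h2 h3
  simp only [hqa] at h4 h5 h6
  refine ⟨d ∘ σ, Tuple.monotone_sort d, fun i => hd _, M, ?_, ?_⟩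
  · rw [SymplecticGroup.mem_iff']
    ext (i | i) (j | j)
    · rw [hentry, hl, hl, h1]; simp [J]
    · rw [hentry, hl, hr, h3]; simp [J, one_apply]
    · rw [hentry, hr, hl, dotProduct_mulVec, ← mulVec_transpose, J_transpose, dotProduct_comm,
        neg_mulVec, dotProduct_neg, h3]
      simp [J, one_apply, eq_comm]
    · rw [hentry, hr, hr, h2]; simp [J]
  · ext (i | i) (j | j)
    · rw [hentry, hl, hl, h4]; simp [diagonal_apply]
    · rw [hentry, hl, hr, h6]; simp
    · rw [hentry, hr, hl, dotProduct_mulVec, ← mulVec_transpose, hsymm, dotProduct_comm, h6]; simp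
    · rw [hentry, hr, hr, h5]; simp [diagonal_apply]

theorem theorem3p3 (n : ℕ) (A B : Matrix (Fin n ⊕ Fin n) (Fin n ⊕ Fin n) ℝ)
    (hA : A.PosSemidef) (hB : B.PosSemidef)
    (hkA : HasSymplecticKernel A) (hkB : HasSymplecticKernel B)
    (hAB : A ∈ convexHull ℝ (symplecticOrbit B)) :
    (∃! a : Fin n → ℝ, IsSymplecticSpectrum A a) ∧
    (∃! b : Fin n → ℝ, IsSymplecticSpectrum B b) ∧
    WeaklySupermajorizedBy (symplecticEigenvalues A) (symplecticEigenvalues B) := by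
  have ha := isSymplecticSpectrum_symplecticEigenvalues (hA.exists_isSymplecticSpectrum hkA)
  have hb := isSymplecticSpectrum_symplecticEigenvalues (hB.exists_isSymplecticSpectrum hkB)
  refine ⟨⟨_, ha, fun _ h => h.unique ha⟩, ⟨_, hb, fun _ h => h.unique hb⟩, fun k => ?_⟩
  rw [sortedIncreasing_eq_self ha.1, sortedIncreasing_eq_self hb.1]
  exact ha.sum_le_of_mem_convexHull hb hAB k
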